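/- **Theorem 3.9** (A waiting process will be elected and enter, symmetric algorithm). Let $p_0,\dots,p_{N-1}$ be processes that communicate through the shared variables $turn\in\{0,\dots,N-1,\text{THINKING},\text{FREE}\}$, initially FREE, and $flag[i]\in\{\text{REMAINDER},\text{WAITING},\text{CANDIDATE}\}$ for $0\le i\le N-1$, initially REMAINDER. Each process starts in its remainder section. Whenever it wants to enter the critical section, $p_i$ runs the following program (with local variables $j$, $nCandidates$, $minCandidate$, $nextTurn$), after which it is again in its remainder section. *Entry part.* 1. $flag[i]\leftarrow\text{WAITING}$. 2. Wait while $turn=\text{THINKING}$. 3. If $turn=\text{FREE}$, then: 1. $flag[i]\leftarrow\text{CANDIDATE}$; 2. while $turn=\text{FREE}$ and $flag[i]=\text{CANDIDATE}$, repeat: - $nCandidates\leftarrow0$ and $minCandidate\leftarrow-1$; - for $j=N-1,N-2,\dots,0$: if $flag[j]=\text{CANDIDATE}$, then $nCandidates\leftarrow nCandidates+1$ and $minCandidate\leftarrow j$; - if $turn=\text{FREE}$ and $nCandidates=1$, then $turn\leftarrow i$; - if $turn\ne\text{FREE}$ or $minCandidate<i$, then $flag[i]\leftarrow\text{WAITING}$;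 3. $flag[i]\leftarrow\text{WAITING}$. 4. Wait while $turn\neq i$; then enter the critical section. *Exit part.* 1. $turn\leftarrow\text{THINKING}$ (by this event $p_i$ leaves the critical section). 2. $flag[i]\leftarrow\text{REMAINDER}$. 3. $nextTurn\leftarrow\text{THINKING}$. 4. For $j=i+1,\dots,N-1,0,\dots,i-1$, as long as $nextTurn=\text{THINKING}$: if $flag[j]\ne\text{REMAINDER}$, then $nextTurn\leftarrow j$. 5. If $nextTurn=\text{THINKING}$, then $turn\leftarrow\text{FREE}$; otherwise $turn\leftarrow nextTurn$. The processes run asynchronously. Their atomic events, each of which is a single test or assignment in the program above (accessing at most one shared variable besides the process's own flag), are interleaved arbitrarily; a process waiting in step 2 or 4 of the entry part has no enabled event as long as the waiting condition holds. The execution is infinite (time steps at which nothing happens are allowed) and weakly fair: every process which from some time on is always outside its remainder section and always has an enabled event performs an event at some later time. In particular no process stays in the critical section forever, while a process may stay in its remainder section forever. Then, in every such execution, for every time $t$ and every process $p_i$ with $flag[i]\ne\text{REMAINDER}$ at time $t$ which is not, at time $t$, just between steps 1 and 2 of its exit part, there are times $t_2\ge t_1\ge t$ such that $turn=i$ at time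 $t_1$ and $p_i$ is in the critical section at time $t_2$. -/

import Mathlib

namespace SymmetricMutex

/-- Values of the shared variable `turn` (and of the local variable `nextTurn`):
the identifier of a process, THINKING, or FREE. -/
inductive Turn (N : ℕ) where
  | proc (k : Fin N)
  | thinking
  | free
deriving DecidableEq

/-- Values of the shared variables `flag[k]`. -/
inductive Flag where
  | remainder
  | waiting
  | candidate
deriving DecidableEq

/-- Control points of process `i`. Each one is followed by a single atomic event, which
accesses at most one shared variable other than the process's own `flag[i]`. -/
inductive PC (N : ℕ) where
  /-- remainder section; next event: `flag[i] ← WAITING` -/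
  | remainder
  /-- wait while `turn = THINKING` -/
  | awaitDecision
  /-- test `turn = FREE` -/
  | testFree
  /-- `flag[i] ← CANDIDATE` -/
  | setCandidate
  /-- loop test: while `turn = FREE ∧ flag[i] = CANDIDATE` -/
  | loopTest
  /-- `nCandidates ← 0`, `minCandidate ← -1`, start the loop `j = N-1, …, 0` -/
  | initCount
  /-- head of the loop over `j`, with the test `flag[j] = CANDIDATE` -/
  | count
  /-- `nCandidates ← nCandidates + 1`, `minCandidate ← j` -/
  | countOne (j : Fin N)
  /-- test `turn = FREE ∧ nCandidates = 1` -/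
  | claimTest
  /-- `turn ← i` -/
  | claim
  /-- test `turn ≠ FREE ∨ minCandidate < i` -/
  | withdrawTest
  /-- `flag[i] ← WAITING`, inside the loop -/
  | withdraw
  /-- `flag[i] ← WAITING`, after the loop -/
  | resetFlag
  /-- wait while `turn ≠ i` -/
  | awaitTurn
  /-- critical section; the process leaves it by the event `turn ← THINKING` -/
  | critical
  /-- `flag[i] ← REMAINDER` -/
  | clearFlag
  /-- `nextTurn ← THINKING`, start the loop `j = i+1, …, N-1, 0, …, i-1` -/
  | initElect
  /-- head of the loop over `j` (while `nextTurn = THINKING`),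
  with the test `flag[j] ≠ REMAINDER` -/
  | elect
  /-- `nextTurn ← j` -/
  | nominate (j : Fin N)
  /-- `turn ← FREE` if `nextTurn = THINKING`, and `turn ← nextTurn` otherwise -/
  | assignTurn
deriving DecidableEq

/-- A global state: the shared variables `turn` and `flag`, and for every process its control
point and its local variables. `scan i` lists the values of the loop variable `j` of process `i`
that the current loop has still to visit, in order. -/
@[ext]
structure Config (N : ℕ) where
  turn : Turn N
  flag : Fin N → Flag
  pc : Fin N → PC N
  scan : Fin N → List (Fin N)
  nCandidates : Fin N → ℕ
  minCandidate : Fin N → ℤ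
  nextTurn : Fin N → Turn N

variable {N : ℕ}

namespace Config

/-- Process `i` moves to control point `p`. -/
def goto (c : Config N) (i : Fin N) (p : PC N) : Config N :=
  { c with pc := Function.update c.pc i p }

/-- `turn ← v`. -/
def setTurn (c : Config N) (v : Turn N) : Config N :=
  { c with turn := v }

/-- `flag[i] ← f`. -/
def setFlag (c : Config N) (i : Fin N) (f : Flag) : Config N :=
  { c with flag := Function.update c.flag i f }

/-- Process `i` sets the list of loop values still to be visited. -/
def setScan (c : Config N) (i : Fin N) (l : List (Fin N)) : Config N :=
  { c with scan := Function.update c.scan i l }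

/-- Process `i` sets its `nCandidates`. -/
def setNCandidates (c : Config N) (i : Fin N) (n : ℕ) : Config N :=
  { c with nCandidates := Function.update c.nCandidates i n }

/-- Process `i` sets its `minCandidate`. -/
def setMinCandidate (c : Config N) (i : Fin N) (m : ℤ) : Config N :=
  { c with minCandidate := Function.update c.minCandidate i m }

/-- Process `i` sets its `nextTurn`. -/
def setNextTurn (c : Config N) (i : Fin N) (v : Turn N) : Config N :=
  { c with nextTurn := Function.update c.nextTurn i v }

/-- The initial states: `turn = FREE`, all flags are REMAINDER, and all processes are in their
remainder section. The local variables are uninitialized. -/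
def IsInitial (c : Config N) : Prop :=
  c.turn = Turn.free ∧ (∀ k, c.flag k = Flag.remainder) ∧ (∀ k, c.pc k = PC.remainder)

end Config

/-- The order `N-1, …, 0`. -/
def countOrder (N : ℕ) : List (Fin N) :=
  (List.finRange N).reverse

/-- The order `i+1, …, N-1, 0, …, i-1`. -/
def electOrder (i : Fin N) : List (Fin N) :=
  (List.finRange N).filter (fun j => i < j) ++ (List.finRange N).filter (fun j => j < i)

/-- The next event of process `i` in state `c`: `some c'` if the event is enabled and leads to
`c'`, and `none` if the process is blocked (it is waiting for a change of `turn`). -/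
def next (i : Fin N) (c : Config N) : Option (Config N) :=
  match c.pc i with
  | .remainder => some ((c.setFlag i .waiting).goto i .awaitDecision)
  | .awaitDecision => if c.turn = .thinking then none else some (c.goto i .testFree)
  | .testFree =>
      if c.turn = .free then some (c.goto i .setCandidate) else some (c.goto i .awaitTurn)
  | .setCandidate => some ((c.setFlag i .candidate).goto i .loopTest)
  | .loopTest =>
      if c.turn = .free ∧ c.flag i = .candidate then some (c.goto i .initCount)
      else some (c.goto i .resetFlag)
  | .initCount =>
      some ((((c.setNCandidates i 0).setMinCandidate i (-1)).setScan i (countOrder N)).goto i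
        .count)
  | .count =>
      match c.scan i with
      | [] => some (c.goto i .claimTest)
      | j :: rest =>
          if c.flag j = .candidate then some ((c.setScan i rest).goto i (.countOne j))
          else some ((c.setScan i rest).goto i .count)
  | .countOne j =>
      some (((c.setNCandidates i (c.nCandidates i + 1)).setMinCandidate i (j.val : ℤ)).goto i
        .count)
  | .claimTest =>
      if c.turn = .free ∧ c.nCandidates i = 1 then some (c.goto i .claim)
      else some (c.goto i .withdrawTest)
  | .claim => some ((c.setTurn (.proc i)).goto i .withdrawTest)
  | .withdrawTest =>
      if c.turn ≠ .free ∨ c.minCandidate i < (i.val : ℤ) then some (c.goto i .withdraw)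
      else some (c.goto i .loopTest)
  | .withdraw => some ((c.setFlag i .waiting).goto i .loopTest)
  | .resetFlag => some ((c.setFlag i .waiting).goto i .awaitTurn)
  | .awaitTurn => if c.turn = .proc i then some (c.goto i .critical) else none
  | .critical => some ((c.setTurn .thinking).goto i .clearFlag)
  | .clearFlag => some ((c.setFlag i .remainder).goto i .initElect)
  | .initElect => some (((c.setNextTurn i .thinking).setScan i (electOrder i)).goto i .elect)
  | .elect =>
      if c.nextTurn i = .thinking then
        match c.scan i with
        | [] => some (c.goto i .assignTurn)
        | j :: rest =>
            if c.flag j ≠ .remainder then some ((c.setScan i rest).goto i (.nominate j))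
            else some ((c.setScan i rest).goto i .elect)
      else some (c.goto i .assignTurn)
  | .nominate j => some ((c.setNextTurn i (.proc j)).goto i .elect)
  | .assignTurn =>
      if c.nextTurn i = .thinking then some ((c.setTurn .free).goto i .remainder)
      else some ((c.setTurn (c.nextTurn i)).goto i .remainder)

/-- `s` is an execution of the algorithm under the schedule `a`: it starts in an initial state,
and at each time `u` either nothing happens (`a u = none`) or one process performs its next
event (`a u = some i`). -/
def IsExecution (s : ℕ → Config N) (a : ℕ → Option (Fin N)) : Prop :=
  (s 0).IsInitial ∧
    ∀ u, (a u = none ∧ s (u + 1) = s u) ∨ (∃ i, a u = some i ∧ next i (s u) = some (s (u + 1)))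

/-- Weak fairness: a process that from some time on is always outside its remainder section and
always has an enabled event performs an event at some later time. In particular no process stays
in its critical section forever, while a process may stay in its remainder section forever. -/
def IsFair (s : ℕ → Config N) (a : ℕ → Option (Fin N)) : Prop :=
  ∀ i t, (∀ u, t ≤ u → (s u).pc i ≠ PC.remainder ∧ (next i (s u)).isSome) →
    ∃ u, t ≤ u ∧ a u = some i

end SymmetricMutex

/-! ### Control points, loop orders and single events -/

namespace SymmetricMutex

variable {N : ℕ}

/-! Suppose a process `i` in its entry part never gets the turn; then it stays there forever. Once
some process `k` has the turn, `k` enters and leaves the critical section. Its election scan runs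
cyclically from `k + 1` and cannot skip `i`, whose flag is not REMAINDER, so the turn passes to a
process strictly closer to `i` in the cyclic order. Descent on this distance gives a contradiction
(`exists_critical`, `exists_closer`, `exists_turn_eq`).

It remains to see that some process gets the turn (`exists_turn_proc`). THINKING cannot last, so
otherwise the turn would be FREE forever. Let `m` be the least process that ever contends during
that time. A process withdraws only for a smaller contender, so `m` never does. Each larger process,
in any count begun after `m` is a candidate, meets `m` and withdraws for good. Finally `m` counts
only itself and claims the turn (`not_forever_free`).

Safety invariants support this. Two concurrent counts cannot both find a single candidate
(`PairInv`), so a pending claim always meets a free turn (`TurnInv`). An exiting process frees the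
turn only when every process is in its remainder section or blocked before the decision, so no stale
loser survives into a free phase (`FreeInv`).

Each progress claim uses a rank that depends only on the flag and local state of one process and
drops at each of its events. By fairness such a process cannot stay enabled outside its remainder
section (`not_enabled`). -/

/-- The control points of the entry part. -/
def PC.IsEntry : PC N → Prop
  | .awaitDecision | .testFree | .setCandidate | .loopTest | .initCount | .count | .countOne _
  | .claimTest | .claim | .withdrawTest | .withdraw | .resetFlag | .awaitTurn => True
  | _ => False

/-- The control points of the entry part behind `flag[i] ← CANDIDATE`. -/
def PC.IsContending : PC N → Prop
  | .loopTest | .initCount | .count | .countOne _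
  | .claimTest | .claim | .withdrawTest | .withdraw | .resetFlag | .awaitTurn => True
  | _ => False

/-- The control points of the exit part behind `turn ← THINKING`. -/
def PC.IsExit : PC N → Prop
  | .clearFlag | .initElect | .elect | .nominate _ | .assignTurn => True
  | _ => False

/-- The control points from the count of the candidates to `turn ← i`. -/
def PC.IsCounting : PC N → Prop
  | .count | .countOne _ | .claimTest | .claim => True
  | _ => False

/-- The flag values that are possible at a control point. -/
def PC.Allows : PC N → Flag → Prop
  | .remainder, f | .initElect, f | .elect, f | .nominate _, f | .assignTurn, f => f = .remainder
  | .awaitDecision, f | .testFree, f | .setCandidate, f | .awaitTurn, f | .critical, f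
  | .clearFlag, f => f = .waiting
  | .initCount, f | .count, f | .countOne _, f | .claimTest, f | .claim, f | .withdrawTest, f
  | .withdraw, f => f = .candidate
  | .loopTest, f | .resetFlag, f => f ≠ .remainder

theorem mem_countOrder (i : Fin N) : i ∈ countOrder N := by simp [countOrder]

theorem length_countOrder : (countOrder N).length = N := by simp [countOrder]

theorem pairwise_countOrder : (countOrder N).Pairwise (· > ·) := by
  simp [countOrder, List.pairwise_reverse, List.pairwise_lt_finRange]

theorem mem_electOrder {i j : Fin N} : j ∈ electOrder i ↔ j ≠ i := by
  simp [electOrder]; omega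

/-- The value of `turn` and the flag and local state of process `i`. -/
structure LocalEq (c : Config N) (i : Fin N) (t : Turn N) (f : Flag) (p : PC N)
    (l : List (Fin N)) (n : ℕ) (m : ℤ) (x : Turn N) : Prop where
  turn : c.turn = t
  flag : c.flag i = f
  pc : c.pc i = p
  scan : c.scan i = l
  nCandidates : c.nCandidates i = n
  minCandidate : c.minCandidate i = m
  nextTurn : c.nextTurn i = x

/-- The events of process `i`, as relations between the states before and after. -/
inductive Event (i : Fin N) (c c' : Config N) : Prop
  | request (hp : c.pc i = .remainder)
      (h' : LocalEq c' i c.turn .waiting .awaitDecision (c.scan i) (c.nCandidates i)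
        (c.minCandidate i) (c.nextTurn i))
  | proceed (hp : c.pc i = .awaitDecision) (hg : c.turn ≠ .thinking)
      (h' : LocalEq c' i c.turn (c.flag i) .testFree (c.scan i) (c.nCandidates i) (c.minCandidate
        i) (c.nextTurn i))
  | free (hp : c.pc i = .testFree) (hg : c.turn = .free)
      (h' : LocalEq c' i c.turn (c.flag i) .setCandidate (c.scan i) (c.nCandidates i)
        (c.minCandidate i) (c.nextTurn i))
  | notFree (hp : c.pc i = .testFree) (hg : c.turn ≠ .free)
      (h' : LocalEq c' i c.turn (c.flag i) .awaitTurn (c.scan i) (c.nCandidates i) (c.minCandidate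
        i) (c.nextTurn i))
  | setCandidate (hp : c.pc i = .setCandidate)
      (h' : LocalEq c' i c.turn .candidate .loopTest (c.scan i) (c.nCandidates i) (c.minCandidate
        i) (c.nextTurn i))
  | loop (hp : c.pc i = .loopTest) (hg : c.turn = .free) (hc : c.flag i = .candidate)
      (h' : LocalEq c' i c.turn (c.flag i) .initCount (c.scan i) (c.nCandidates i) (c.minCandidate
        i) (c.nextTurn i))
  | leave (hp : c.pc i = .loopTest) (hg : c.turn = .free → c.flag i ≠ .candidate)
      (h' : LocalEq c' i c.turn (c.flag i) .resetFlag (c.scan i) (c.nCandidates i) (c.minCandidate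
        i) (c.nextTurn i))
  | initCount (hp : c.pc i = .initCount)
      (h' : LocalEq c' i c.turn (c.flag i) .count (countOrder N) 0 (-1) (c.nextTurn i))
  | countEnd (hp : c.pc i = .count) (hs : c.scan i = [])
      (h' : LocalEq c' i c.turn (c.flag i) .claimTest (c.scan i) (c.nCandidates i) (c.minCandidate
        i) (c.nextTurn i))
  | countHit (j : Fin N) (l : List (Fin N)) (hp : c.pc i = .count)
      (hs : c.scan i = j :: l) (hc : c.flag j = .candidate)
      (h' : LocalEq c' i c.turn (c.flag i) (.countOne j) l (c.nCandidates i) (c.minCandidate i)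
        (c.nextTurn i))
  | countMiss (j : Fin N) (l : List (Fin N)) (hp : c.pc i = .count)
      (hs : c.scan i = j :: l) (hc : c.flag j ≠ .candidate)
      (h' : LocalEq c' i c.turn (c.flag i) .count l (c.nCandidates i) (c.minCandidate i)
        (c.nextTurn i))
  | countOne (j : Fin N) (hp : c.pc i = .countOne j)
      (h' : LocalEq c' i c.turn (c.flag i) .count (c.scan i) (c.nCandidates i + 1) (j.val : ℤ)
        (c.nextTurn i))
  | alone (hp : c.pc i = .claimTest) (hg : c.turn = .free) (hn : c.nCandidates i = 1)
      (h' : LocalEq c' i c.turn (c.flag i) .claim (c.scan i) (c.nCandidates i) (c.minCandidate i)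
        (c.nextTurn i))
  | notAlone (hp : c.pc i = .claimTest) (hg : c.turn = .free → c.nCandidates i ≠ 1)
      (h' : LocalEq c' i c.turn (c.flag i) .withdrawTest (c.scan i) (c.nCandidates i)
        (c.minCandidate i) (c.nextTurn i))
  | claim (hp : c.pc i = .claim)
      (h' : LocalEq c' i (.proc i) (c.flag i) .withdrawTest (c.scan i) (c.nCandidates i)
        (c.minCandidate i) (c.nextTurn i))
  | giveUp (hp : c.pc i = .withdrawTest) (hg : c.turn = .free → c.minCandidate i < (i.val : ℤ))
      (h' : LocalEq c' i c.turn (c.flag i) .withdraw (c.scan i) (c.nCandidates i) (c.minCandidate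
        i) (c.nextTurn i))
  | retry (hp : c.pc i = .withdrawTest) (hg : c.turn = .free) (hm : (i.val : ℤ) ≤ c.minCandidate i)
      (h' : LocalEq c' i c.turn (c.flag i) .loopTest (c.scan i) (c.nCandidates i) (c.minCandidate
        i) (c.nextTurn i))
  | withdraw (hp : c.pc i = .withdraw)
      (h' : LocalEq c' i c.turn .waiting .loopTest (c.scan i) (c.nCandidates i) (c.minCandidate i)
        (c.nextTurn i))
  | resetFlag (hp : c.pc i = .resetFlag)
      (h' : LocalEq c' i c.turn .waiting .awaitTurn (c.scan i) (c.nCandidates i) (c.minCandidate i)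
        (c.nextTurn i))
  | enter (hp : c.pc i = .awaitTurn) (hg : c.turn = .proc i)
      (h' : LocalEq c' i c.turn (c.flag i) .critical (c.scan i) (c.nCandidates i) (c.minCandidate
        i) (c.nextTurn i))
  | exit (hp : c.pc i = .critical)
      (h' : LocalEq c' i .thinking (c.flag i) .clearFlag (c.scan i) (c.nCandidates i)
        (c.minCandidate i) (c.nextTurn i))
  | clearFlag (hp : c.pc i = .clearFlag)
      (h' : LocalEq c' i c.turn .remainder .initElect (c.scan i) (c.nCandidates i) (c.minCandidate
        i) (c.nextTurn i))
  | initElect (hp : c.pc i = .initElect)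
      (h' : LocalEq c' i c.turn (c.flag i) .elect (electOrder i) (c.nCandidates i) (c.minCandidate
        i) .thinking)
  | electEnd (hp : c.pc i = .elect) (hn : c.nextTurn i = .thinking) (hs : c.scan i = [])
      (h' : LocalEq c' i c.turn (c.flag i) .assignTurn (c.scan i) (c.nCandidates i) (c.minCandidate
        i) (c.nextTurn i))
  | electHit (j : Fin N) (l : List (Fin N)) (hp : c.pc i = .elect) (hn : c.nextTurn i = .thinking)
      (hs : c.scan i = j :: l) (hc : c.flag j ≠ .remainder)
      (h' : LocalEq c' i c.turn (c.flag i) (.nominate j) l (c.nCandidates i) (c.minCandidate i)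
        (c.nextTurn i))
  | electMiss (j : Fin N) (l : List (Fin N)) (hp : c.pc i = .elect) (hn : c.nextTurn i = .thinking)
      (hs : c.scan i = j :: l) (hc : c.flag j = .remainder)
      (h' : LocalEq c' i c.turn (c.flag i) .elect l (c.nCandidates i) (c.minCandidate i)
        (c.nextTurn i))
  | elected (hp : c.pc i = .elect) (hn : c.nextTurn i ≠ .thinking)
      (h' : LocalEq c' i c.turn (c.flag i) .assignTurn (c.scan i) (c.nCandidates i) (c.minCandidate
        i) (c.nextTurn i))
  | nominate (j : Fin N) (hp : c.pc i = .nominate j)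
      (h' : LocalEq c' i c.turn (c.flag i) .elect (c.scan i) (c.nCandidates i) (c.minCandidate i)
        (.proc j))
  | release (hp : c.pc i = .assignTurn) (hn : c.nextTurn i = .thinking)
      (h' : LocalEq c' i .free (c.flag i) .remainder (c.scan i) (c.nCandidates i) (c.minCandidate
        i) (c.nextTurn i))
  | pass (hp : c.pc i = .assignTurn) (hn : c.nextTurn i ≠ .thinking)
      (h' : LocalEq c' i (c.nextTurn i) (c.flag i) .remainder (c.scan i) (c.nCandidates i)
        (c.minCandidate i) (c.nextTurn i))

/-- An event of process `i` changes neither the flag nor the local state of another process. -/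
theorem next_other {i j : Fin N} {c c' : Config N} (h : next i c = some c') (hj : j ≠ i) :
    c'.flag j = c.flag j ∧ c'.pc j = c.pc j ∧ c'.scan j = c.scan j ∧
      c'.nCandidates j = c.nCandidates j ∧ c'.minCandidate j = c.minCandidate j ∧
      c'.nextTurn j = c.nextTurn j := by
  unfold next at h
  repeat' split at h
  all_goals
    simp only [Option.some.injEq, reduceCtorEq] at h
  all_goals
    subst h
    simp [Config.goto, Config.setTurn, Config.setFlag, Config.setScan, Config.setNCandidates,
      Config.setMinCandidate, Config.setNextTurn, hj]

/-- Reduces each invariant check to one case per event, recording the turn and the acting process's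
own data; the data of the others come from `next_other`. -/
theorem event_of_next {i : Fin N} {c c' : Config N} (h : next i c = some c') : Event i c c' := by
  simp only [next, Config.goto, Config.setTurn, Config.setFlag, Config.setScan,
    Config.setNCandidates, Config.setMinCandidate, Config.setNextTurn] at h
  cases hp : c.pc i with
  | remainder =>
    simp only [hp, Option.some.injEq] at h
    subst h
    exact .request hp (by constructor <;> simp)
  | awaitDecision =>
    simp only [hp, Option.ite_none_left_eq_some, Option.some.injEq] at h
    obtain ⟨hg, rfl⟩ := h
    exact .proceed hp hg (by constructor <;> simp)
  | testFree =>
    simp only [hp] at h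
    split at h <;> rename_i hg <;>
      simp only [Option.some.injEq] at h <;> subst h
    · exact .free hp hg (by constructor <;> simp)
    · exact .notFree hp hg (by constructor <;> simp)
  | setCandidate =>
    simp only [hp, Option.some.injEq] at h
    subst h
    exact .setCandidate hp (by constructor <;> simp)
  | loopTest =>
    simp only [hp] at h
    split at h <;> rename_i hg <;>
      simp only [Option.some.injEq] at h <;> subst h
    · exact .loop hp hg.1 hg.2 (by constructor <;> simp)
    · exact .leave hp (not_and.1 hg) (by constructor <;> simp)
  | initCount =>
    simp only [hp, Option.some.injEq] at h
    subst h
    exact .initCount hp (by constructor <;> simp)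
  | count =>
    simp only [hp] at h
    split at h <;> rename_i hs
    · simp only [Option.some.injEq] at h
      subst h
      exact .countEnd hp hs (by constructor <;> simp)
    · split at h <;> rename_i hg <;> simp only [Option.some.injEq] at h <;> subst h
      · exact .countHit _ _ hp hs hg (by constructor <;> simp)
      · exact .countMiss _ _ hp hs hg (by constructor <;> simp)
  | countOne j =>
    simp only [hp, Option.some.injEq] at h
    subst h
    exact .countOne j hp (by constructor <;> simp)
  | claimTest =>
    simp only [hp] at h
    split at h <;> rename_i hg <;>
      simp only [Option.some.injEq] at h <;> subst h
    · exact .alone hp hg.1 hg.2 (by constructor <;> simp)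
    · exact .notAlone hp (not_and.1 hg) (by constructor <;> simp)
  | claim =>
    simp only [hp, Option.some.injEq] at h
    subst h
    exact .claim hp (by constructor <;> simp)
  | withdrawTest =>
    simp only [hp] at h
    split at h <;> rename_i hg <;>
      simp only [Option.some.injEq] at h <;> subst h
    · exact .giveUp hp (by tauto) (by constructor <;> simp)
    · exact .retry hp (by tauto) (by push Not at hg; exact hg.2) (by constructor <;> simp)
  | withdraw =>
    simp only [hp, Option.some.injEq] at h
    subst h
    exact .withdraw hp (by constructor <;> simp)
  | resetFlag =>
    simp only [hp, Option.some.injEq] at h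
    subst h
    exact .resetFlag hp (by constructor <;> simp)
  | awaitTurn =>
    simp only [hp, Option.ite_none_right_eq_some, Option.some.injEq] at h
    obtain ⟨hg, rfl⟩ := h
    exact .enter hp hg (by constructor <;> simp)
  | critical =>
    simp only [hp, Option.some.injEq] at h
    subst h
    exact .exit hp (by constructor <;> simp)
  | clearFlag =>
    simp only [hp, Option.some.injEq] at h
    subst h
    exact .clearFlag hp (by constructor <;> simp)
  | initElect =>
    simp only [hp, Option.some.injEq] at h
    subst h
    exact .initElect hp (by constructor <;> simp)
  | elect =>
    simp only [hp] at h
    split at h <;> rename_i hn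
    · split at h <;> rename_i hs
      · simp only [Option.some.injEq] at h
        subst h
        exact .electEnd hp hn hs (by constructor <;> simp)
      · split at h <;> rename_i hg <;> simp only [Option.some.injEq] at h <;> subst h
        · exact .electHit _ _ hp hn hs hg (by constructor <;> simp)
        · exact .electMiss _ _ hp hn hs (not_not.1 hg) (by constructor <;> simp)
    · simp only [Option.some.injEq] at h
      subst h
      exact .elected hp hn (by constructor <;> simp)
  | nominate j =>
    simp only [hp, Option.some.injEq] at h
    subst h
    exact .nominate j hp (by constructor <;> simp)
  | assignTurn =>
    simp only [hp] at h
    split at h <;> rename_i hg <;>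
      simp only [Option.some.injEq] at h <;> subst h
    · exact .release hp hg (by constructor <;> simp)
    · exact .pass hp hg (by constructor <;> simp)

/-! ### Invariants of the candidate count -/

theorem allows_step {i : Fin N} {c c' : Config N} (h : next i c = some c')
    (hI : ∀ k, (c.pc k).Allows (c.flag k)) (k : Fin N) : (c'.pc k).Allows (c'.flag k) := by
  rcases eq_or_ne k i with rfl | hk
  · have hk := hI k
    cases event_of_next h <;> rename_i h' <;> obtain ⟨h1, h2, h3, h4, h5, h6, h7⟩ := h' <;>
    grind [PC.Allows]
  · obtain ⟨h1, h2, -⟩ := next_other h hk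
    rw [h1, h2]; exact hI k

/-- The local facts about the count of the candidates by process `i`. -/
structure CountInv (c : Config N) (i : Fin N) : Prop where
  sorted : c.pc i = .count ∨ (∃ j, c.pc i = .countOne j) → (c.scan i).Pairwise (· > ·)
  done : c.pc i = .claimTest ∨ c.pc i = .claim ∨ c.pc i = .withdrawTest → c.scan i = []
  lt_one : ∀ j, c.pc i = .countOne j → ∀ x ∈ c.scan i, x < j
  lt_min : (c.pc i = .count ∨ ∃ j, c.pc i = .countOne j) → 0 ≤ c.minCandidate i →
    ∀ x ∈ c.scan i, (x.val : ℤ) < c.minCandidate i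
  one_lt_min : ∀ j, c.pc i = .countOne j → 0 ≤ c.minCandidate i → (j.val : ℤ) < c.minCandidate i
  nonneg : (c.pc i).IsCounting ∨ c.pc i = .withdrawTest → i ∉ c.scan i → c.pc i ≠ .countOne i →
    0 ≤ c.minCandidate i
  counted : (c.pc i).IsCounting → i ∉ c.scan i → c.pc i ≠ .countOne i → 1 ≤ c.nCandidates i

/-- A counting process has flag CANDIDATE, so its visit to itself is a hit; this gives `nonneg` and
`counted`. The comparisons with `minCandidate` hold because the scan descends. -/
theorem countInv_step {i : Fin N} {c c' : Config N} (h : next i c = some c')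
    (hA : ∀ k, (c.pc k).Allows (c.flag k)) (hI : ∀ k, CountInv c k) (k : Fin N) :
    CountInv c' k := by
  rcases eq_or_ne k i with rfl | hk
  · have hf := hA k
    have hs := pairwise_countOrder (N := N)
    have hm := mem_countOrder k
    obtain ⟨h1, h2, h3, h4, h5, h6, h7⟩ := hI k
    cases event_of_next h <;> rename_i h' <;> obtain ⟨g1, g2, g3, g4, g5, g6, g7⟩ := h' <;>
    constructor <;> grind [PC.Allows, PC.IsCounting, List.pairwise_cons]
  · obtain ⟨g1, g2, g3, g4, g5, g6⟩ := next_other h hk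
    obtain ⟨h1, h2, h3, h4, h5, h6, h7⟩ := hI k
    constructor <;> simpa only [g1, g2, g3, g4, g5, g6]

/-- The number of candidates that process `i` has seen in its current count. -/
def observed (c : Config N) (i : Fin N) : ℕ :=
  c.nCandidates i + match c.pc i with
    | .countOne _ => 1
    | _ => 0

/-- The number of times that process `i` has come across itself in its current count. -/
def selfVisits (c : Config N) (i : Fin N) : ℕ := if i ∈ c.scan i then 0 else 1

/-- If two processes have passed each other in their counts, then one of them has seen a
candidate different from itself. -/
def PairInv (c : Config N) (i j : Fin N) : Prop :=
  (c.pc i).IsCounting → (c.pc j).IsCounting → j ∉ c.scan i → i ∉ c.scan j →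
    selfVisits c i < observed c i ∨ selfVisits c j < observed c j

theorem PairInv.symm {c : Config N} {i j : Fin N} (h : PairInv c i j) : PairInv c j i :=
  fun h1 h2 h3 h4 => (h h2 h1 h4 h3).symm

theorem CountInv.selfVisits_le {c : Config N} {i : Fin N} (h : CountInv c i)
    (hc : (c.pc i).IsCounting) : selfVisits c i ≤ observed c i := by
  have := h.counted hc
  unfold selfVisits observed
  by_cases hp : c.pc i = .countOne i
  · grind
  · grind

theorem PC.Allows.candidate {p : PC N} {f : Flag} (h : p.Allows f) (hp : p.IsCounting) :
    f = .candidate := by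
  cases p <;> simp_all [PC.IsCounting, PC.Allows]

/-- The later of the two mutual visits finds the other process counting, hence a candidate, and
raises `observed` but not `selfVisits`. A visit to itself raises both by one, so a strict inequality
is kept. -/
theorem PairInv.step_left {i j : Fin N} {c c' : Config N} (h : next i c = some c') (hj : j ≠ i)
    (hA : ∀ k, (c.pc k).Allows (c.flag k)) (hC : ∀ k, CountInv c k) (hP : PairInv c i j) :
    PairInv c' i j := by
  obtain ⟨f1, f2, f3, f4, f5, f6⟩ := next_other h hj
  have hs := (hC i).sorted
  have hm := mem_countOrder i
  have hm' := mem_countOrder j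
  have hci := (hA i).candidate
  have hcj := (hA j).candidate
  have hge := (hC i).selfVisits_le
  unfold PairInv selfVisits observed at *
  rw [f2, f3, f4]
  cases event_of_next h <;> rename_i h' <;> obtain ⟨g1, g2, g3, g4, g5, g6, g7⟩ := h' <;>
    rw [g3, g4, g5] <;>
    first
    | exact fun h => h.elim
    | (clear f1 f2 f3 f4 f5 f6 g1 g2 g3 g4 g5 g6 g7 h hA hC
       grind [PC.IsCounting, List.pairwise_cons])

theorem pairInv_step {k : Fin N} {c c' : Config N} (h : next k c = some c')
    (hA : ∀ k, (c.pc k).Allows (c.flag k)) (hC : ∀ k, CountInv c k)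
    (hP : ∀ i j, i ≠ j → PairInv c i j) (i j : Fin N) (hij : i ≠ j) : PairInv c' i j := by
  rcases eq_or_ne i k with rfl | hi
  · exact (hP i j hij).step_left h hij.symm hA hC
  rcases eq_or_ne j k with rfl | hj
  · exact ((hP j i hij.symm).step_left h hij hA hC).symm
  obtain ⟨-, f2, f3, f4, -⟩ := next_other h hi
  obtain ⟨-, g2, g3, g4, -⟩ := next_other h hj
  have := hP i j hij
  unfold PairInv selfVisits observed at *
  simpa only [f2, f3, f4, g2, g3, g4]

/-- Two processes cannot both have found themselves to be the only candidate. -/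
theorem PairInv.not_both_alone {c : Config N} {i j : Fin N} (h : PairInv c i j)
    (hi : CountInv c i) (hj : CountInv c j)
    (hpi : c.pc i = .claimTest ∨ c.pc i = .claim) (hpj : c.pc j = .claimTest ∨ c.pc j = .claim)
    (hni : c.nCandidates i = 1) (hnj : c.nCandidates j = 1) : False := by
  -- With both scans exhausted, `selfVisits` and `observed` are both 1, so neither strict inequality
  -- of `PairInv` can hold.
  have h1 := hi.done (by tauto)
  have h2 := hj.done (by tauto)
  unfold PairInv selfVisits observed at h
  rcases hpi with hpi | hpi <;> rcases hpj with hpj | hpj <;>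
    simp [hpi, hpj, h1, h2, hni, hnj, PC.IsCounting] at h

/-! ### Consistency of the turn -/

/-- The facts about the holder of the turn. -/
structure TurnInv (c : Config N) : Prop where
  critical : ∀ j, c.pc j = .critical → c.turn = .proc j
  exit : ∀ j, (c.pc j).IsExit → c.turn = .thinking
  exit_unique : ∀ j k, (c.pc j).IsExit → (c.pc k).IsExit → j = k
  thinking : c.turn = .thinking → ∃ j, (c.pc j).IsExit
  proc : ∀ k, c.turn = .proc k → (c.pc k).IsEntry ∨ c.pc k = .critical
  claim : ∀ i, c.pc i = .claim → c.turn = .free ∧ c.nCandidates i = 1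
  nominate : ∀ i j, c.pc i = .nominate j → (c.pc j).IsEntry
  nextTurn : ∀ i j, c.pc i = .elect ∨ c.pc i = .assignTurn → c.nextTurn i = .proc j →
    (c.pc j).IsEntry
  nextTurn_ne : ∀ i, c.pc i = .elect ∨ c.pc i = .assignTurn → c.nextTurn i ≠ .free

theorem PC.Allows.cases {p : PC N} {f : Flag} (h : p.Allows f) (hf : f ≠ .remainder) :
    p.IsEntry ∨ p = .critical ∨ p = .clearFlag := by
  cases p <;> simp_all [PC.IsEntry, PC.Allows]

/-- Ensures that a nominated process is still in its entry part when the turn reaches it. -/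
theorem next_entry {i k : Fin N} {c c' : Config N} (h : next i c = some c')
    (hk : (c.pc k).IsEntry) : (c'.pc k).IsEntry ∨ c'.pc k = .critical ∧ c.turn = .proc k := by
  rcases eq_or_ne k i with rfl | hki
  · cases event_of_next h <;> rename_i h' <;> have := h'.pc <;> grind [PC.IsEntry]
  · rw [(next_other h hki).2.1]
    exact .inl hk

-- Claims are exclusive by `not_both_alone`, so no other claim is pending when the turn is taken. A
-- nominee has a flag other than REMAINDER; it is not critical because the turn is THINKING, nor at
-- `clearFlag` because the exiting process is unique, so it is in its entry part.
set_option maxHeartbeats 4000000 in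
theorem turnInv_step {i : Fin N} {c c' : Config N} (h : next i c = some c')
    (hA : ∀ k, (c.pc k).Allows (c.flag k)) (hC : ∀ k, CountInv c k)
    (hP : ∀ i j, i ≠ j → PairInv c i j) (hT : TurnInv c) : TurnInv c' := by
  have hf : ∀ k, c.flag k ≠ .remainder → _ := fun k => (hA k).cases
  have hne : ∀ j, j ≠ i → c.pc i = .claimTest → c.pc j = .claim → c.nCandidates i = 1 →
      c.nCandidates j = 1 → False := fun j hj h1 h2 h3 h4 =>
    (hP i j hj.symm).not_both_alone (hC i) (hC j) (.inl h1) (.inr h2) h3 h4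
  have hne' : ∀ j, j ≠ i → c.pc i = .claim → c.pc j = .claim → c.nCandidates i = 1 →
      c.nCandidates j = 1 → False := fun j hj h1 h2 h3 h4 =>
    (hP i j hj.symm).not_both_alone (hC i) (hC j) (.inr h1) (.inr h2) h3 h4
  have ho : ∀ j, j ≠ i → c'.pc j = c.pc j := fun j hj => (next_other h hj).2.1
  have hon : ∀ j, j ≠ i → c'.nextTurn j = c.nextTurn j := fun j hj =>
    (next_other h hj).2.2.2.2.2
  have hoc : ∀ j, j ≠ i → c'.nCandidates j = c.nCandidates j := fun j hj =>
    (next_other h hj).2.2.2.1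
  have he := fun k => next_entry h (k := k)
  obtain ⟨h1, h2, h3, h4, h5, h6, h7, h8, h9⟩ := hT
  cases event_of_next h <;> rename_i h' <;> obtain ⟨g1, g2, g3, g4, g5, g6, g7⟩ := h' <;>
    clear hA hC hP h g2 g4 g6 <;> constructor <;>
    grind [PC.IsEntry, PC.IsExit]

/-! ### Contenders while the turn is free -/

/-- The facts about the scan in the exit part, which finds only processes that cannot proceed
before the turn is assigned, and about the candidates while the turn is free. -/
structure FreeInv (c : Config N) : Prop where
  passed : ∀ i j, c.pc i = .elect ∨ c.pc i = .assignTurn → c.nextTurn i = .thinking → j ≠ i →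
    j ∉ c.scan i → c.pc j = .remainder ∨ c.pc j = .awaitDecision
  scanned : ∀ i, c.pc i = .assignTurn → c.nextTurn i = .thinking → c.scan i = []
  min : c.turn = .free → ∀ i, (c.pc i).IsCounting ∨ c.pc i = .withdrawTest →
    0 ≤ c.minCandidate i → ∃ j, (c.pc j).IsContending ∧ (j.val : ℤ) = c.minCandidate i
  one : c.turn = .free → ∀ i j, c.pc i = .countOne j → (c.pc j).IsContending
  withdrawing : c.turn = .free → ∀ i, c.pc i = .withdraw ∨ c.pc i = .resetFlag ∨
    c.pc i = .awaitTurn ∨ c.pc i = .loopTest ∧ c.flag i ≠ .candidate →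
    ∃ j < i, (c.pc j).IsContending

theorem PC.Allows.contending {p : PC N} {f : Flag} (h : p.Allows f) (hf : f = .candidate) :
    p.IsContending := by
  cases p <;> simp_all [PC.IsContending, PC.Allows]

theorem PC.Allows.remainder {p : PC N} {f : Flag} (h : p.Allows f) (hf : f = .remainder) :
    p = .remainder ∨ p.IsExit := by
  cases p <;> simp_all [PC.IsExit, PC.Allows]

theorem next_contending {i k : Fin N} {c c' : Config N} (h : next i c = some c')
    (ht : c'.turn = .free) (hT : TurnInv c) (hk : (c.pc k).IsContending) :
    (c'.pc k).IsContending := by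
  have := hT.exit
  have := hT.critical
  rcases eq_or_ne k i with rfl | hki
  · cases event_of_next h <;> rename_i h' <;> have := h'.pc <;> have := h'.turn <;>
      grind [PC.IsContending]
  · rwa [(next_other h hki).2.1]

/-- The turn becomes free only when all processes are in the remainder section or wait for the
decision. -/
theorem next_free {i : Fin N} {c c' : Config N} (h : next i c = some c')
    (ht : c'.turn = .free) (hT : TurnInv c) (hF : FreeInv c) : c.turn = .free ∨
    ∀ j, c'.pc j = .remainder ∨ c'.pc j = .awaitDecision := by
  have ho : ∀ j, j ≠ i → c'.pc j = c.pc j := fun j hj => (next_other h hj).2.1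
  have hp := hF.passed i
  have hs := hF.scanned i
  have hn := hT.nextTurn_ne i
  cases event_of_next h <;> rename_i h' <;> have := h'.pc <;> have := h'.turn <;> grind

-- The clauses about a free turn hold vacuously when the turn has just become free, by `next_free`;
-- afterwards they persist because contenders remain contenders.
set_option maxHeartbeats 1000000 in
theorem freeInv_step {i : Fin N} {c c' : Config N} (h : next i c = some c')
    (hA : ∀ k, (c.pc k).Allows (c.flag k)) (hC : ∀ k, CountInv c k)
    (hT : TurnInv c) (hF : FreeInv c) : FreeInv c' := by
  have ho : ∀ j, j ≠ i → c'.pc j = c.pc j := fun j hj => (next_other h hj).2.1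
  have hon : ∀ j, j ≠ i → c'.nextTurn j = c.nextTurn j := fun j hj =>
    (next_other h hj).2.2.2.2.2
  have hom : ∀ j, j ≠ i → c'.minCandidate j = c.minCandidate j := fun j hj =>
    (next_other h hj).2.2.2.2.1
  have hos : ∀ j, j ≠ i → c'.scan j = c.scan j := fun j hj => (next_other h hj).2.2.1
  have hof : ∀ j, j ≠ i → c'.flag j = c.flag j := fun j hj => (next_other h hj).1
  have hcont := fun k hf => next_contending (k := k) h hf hT
  have hfree := fun hf => next_free h hf hT hF
  obtain ⟨h1, h2, h3, h4, h5⟩ := hF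
  have hA' : ∀ k, c.flag k = .candidate → _ := fun k => (hA k).contending
  have hex := hT.exit
  refine ⟨?_, ?_, fun hf => ?_, fun hf => ?_, fun hf => ?_⟩
  -- A process passed over has flag REMAINDER and, as the exiting process is unique, is in its
  -- remainder section. While the turn is THINKING it can advance only to `awaitDecision`, where it
  -- is blocked.
  · clear hcont hfree hA' h3 h4 h5 hC
    have hme := @mem_electOrder N i
    intro k j
    have hA1 : c.flag j = .remainder → c.pc j = .remainder ∨ (c.pc j).IsExit := (hA j).remainder
    have hex1 := hex k
    have hun := hT.exit_unique k j
    have h1 := h1 k j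
    clear hA hT
    cases event_of_next h <;> rename_i h' <;> obtain ⟨g1, g2, g3, g4, g5, g6, g7⟩ := h' <;>
      clear h <;> grind [PC.IsExit]
  · intro k
    cases event_of_next h <;> rename_i h' <;> obtain ⟨g1, g2, g3, g4, g5, g6, g7⟩ := h' <;>
      clear h <;> grind
  all_goals
    have hcont := fun k => hcont k hf
    rcases hfree hf with hf' | hall
    swap
    · clear hA' hC hA hT hfree h1 h2 h3 h4 h5 hcont
      grind [PC.IsCounting]
  · intro k
    clear h1 h2 h5 hC hfree hT hex hA hos hof hon
    have h3 := h3 hf' k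
    have h4 := h4 hf' k
    cases event_of_next h <;> rename_i h' <;> obtain ⟨g1, g2, g3, g4, g5, g6, g7⟩ := h' <;>
      clear h <;> grind [PC.IsCounting]
  · intro k j
    have h4 := h4 hf' k j
    cases event_of_next h <;> rename_i h' <;> obtain ⟨g1, g2, g3, g4, g5, g6, g7⟩ := h' <;>
      clear h <;> grind
  -- At `withdrawTest` the process has visited itself, so `minCandidate` is no longer the initial
  -- -1: a value below `k` names a genuine smaller contender.
  · intro k
    have h5 := h5 hf' k
    have h3 := h3 hf' k
    have hd := (hC k).done
    have hn := (hC k).nonneg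
    have hA1 := hA k
    clear hA' hC hA hT hfree h1 h2 h4
    cases event_of_next h <;> rename_i h' <;> obtain ⟨g1, g2, g3, g4, g5, g6, g7⟩ := h' <;>
      clear h <;> grind [PC.Allows]

/-- The conjunction of the invariants. -/
structure Inv (c : Config N) : Prop where
  allows : ∀ k, (c.pc k).Allows (c.flag k)
  count : ∀ k, CountInv c k
  pair : ∀ i j, i ≠ j → PairInv c i j
  turn : TurnInv c
  free : FreeInv c

theorem Inv.step {i : Fin N} {c c' : Config N} (h : next i c = some c') (hI : Inv c) : Inv c' :=
  ⟨allows_step h hI.allows, countInv_step h hI.allows hI.count,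
    pairInv_step h hI.allows hI.count hI.pair, turnInv_step h hI.allows hI.count hI.pair hI.turn,
    freeInv_step h hI.allows hI.count hI.turn hI.free⟩

theorem Config.IsInitial.inv {c : Config N} (h : c.IsInitial) : Inv c := by
  obtain ⟨h1, h2, h3⟩ := h
  constructor
  · simp [h2, h3, PC.Allows]
  · intro k; constructor <;> simp [h3, PC.IsCounting]
  · simp [PairInv, h3, PC.IsCounting]
  · constructor <;> simp [h1, h3, PC.IsExit]
  · constructor <;> simp [h3, PC.IsCounting]

theorem IsExecution.inv {s : ℕ → Config N} {a : ℕ → Option (Fin N)} (h : IsExecution s a)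
    (u : ℕ) : Inv (s u) := by
  induction u with
  | zero => exact h.1.inv
  | succ u ih =>
    rcases h.2 u with ⟨-, h⟩ | ⟨i, -, h⟩
    · rwa [h]
    · exact ih.step h

/-! ### Local ranks and fairness -/

/-- A quantity depends only on the flag and the local state of process `j`. -/
def IsLocal {α : Type*} (j : Fin N) (r : Config N → α) : Prop :=
  ∀ c c' : Config N, c'.flag j = c.flag j → c'.pc j = c.pc j → c'.scan j = c.scan j →
    c'.nCandidates j = c.nCandidates j → c'.minCandidate j = c.minCandidate j →
    c'.nextTurn j = c.nextTurn j → r c' = r c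

section Execution

variable {s : ℕ → Config N} {a : ℕ → Option (Fin N)}

theorem IsExecution.step (h : IsExecution s a) (u : ℕ) :
    s (u + 1) = s u ∨ ∃ i, next i (s u) = some (s (u + 1)) := by
  rcases h.2 u with ⟨-, h⟩ | ⟨i, -, h⟩
  · exact .inl h
  · exact .inr ⟨i, h⟩

theorem IsExecution.of_ne (h : IsExecution s a) {j : Fin N} {u : ℕ} (hj : a u ≠ some j) :
    s (u + 1) = s u ∨ ∃ i, j ≠ i ∧ next i (s u) = some (s (u + 1)) := by
  rcases h.2 u with ⟨-, h⟩ | ⟨i, hi, h⟩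
  · exact .inl h
  · exact .inr ⟨i, by rintro rfl; exact hj hi, h⟩

theorem IsExecution.local_of_ne (h : IsExecution s a) {α : Type*} {j : Fin N} {r : Config N → α}
    (hr : IsLocal j r) {u : ℕ} (hj : a u ≠ some j) : r (s (u + 1)) = r (s u) := by
  rcases h.of_ne hj with h | ⟨i, hi, h⟩
  · rw [h]
  · obtain ⟨h1, h2, h3, h4, h5, h6⟩ := next_other h hi
    exact hr _ _ h1 h2 h3 h4 h5 h6

/-- A process whose events decrease a local rank performs only finitely many of them. -/
theorem IsExecution.eventually_ne (h : IsExecution s a) {j : Fin N} {r : Config N → ℕ}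
    (hr : IsLocal j r) {T : ℕ}
    (hdec : ∀ u, T ≤ u → next j (s u) = some (s (u + 1)) → r (s (u + 1)) < r (s u)) :
    ∃ T', T ≤ T' ∧ ∀ u, T' ≤ u → a u ≠ some j := by
  -- Strong induction on the rank: locality keeps it constant between events of `j`, and each such
  -- event lowers it.
  have key : ∀ n u, T ≤ u → r (s u) = n → ∃ T', T ≤ T' ∧ ∀ u, T' ≤ u → a u ≠ some j := by
    intro n
    induction n using Nat.strong_induction_on with
    | _ n ih =>
      intro u hu hn
      by_contra! hc
      obtain ⟨v, hv, hav⟩ := hc u hu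
      have hstep : ∀ w, T ≤ w → a w = some j → r (s (w + 1)) < r (s w) := by
        intro w hw haw
        rcases h.2 w with ⟨h0, -⟩ | ⟨i, hi, h1⟩
        · simp [h0] at haw
        · rw [haw, Option.some.injEq] at hi
          subst hi
          exact hdec w hw h1
      have hle : r (s v) ≤ r (s u) := by
        clear hav
        induction v, hv using Nat.le_induction with
        | base => exact le_rfl
        | succ v hv ih =>
          refine le_trans ?_ ih
          by_cases hav : a v = some j
          · exact (hstep v (hu.trans hv) hav).le
          · exact (h.local_of_ne hr hav).le
      obtain ⟨T', hT, hT'⟩ := ih _ ((hstep v (hu.trans hv) hav).trans_le (hle.trans hn.le))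
        (v + 1) (by omega) rfl
      obtain ⟨w, hw, haw⟩ := hc T' hT
      exact hT' w hw haw
  exact key _ T le_rfl rfl

/-- A process cannot stay outside its remainder section, with an enabled event, while its events
decrease a local rank. -/
theorem IsExecution.not_enabled (h : IsExecution s a) (hf : IsFair s a) {j : Fin N}
    {r : Config N → ℕ} (hr : IsLocal j r) {T : ℕ}
    (hen : ∀ u, T ≤ u → (s u).pc j ≠ PC.remainder ∧ (next j (s u)).isSome)
    (hdec : ∀ u, T ≤ u → next j (s u) = some (s (u + 1)) → r (s (u + 1)) < r (s u)) : False := by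
  obtain ⟨T', hT, hT'⟩ := h.eventually_ne hr hdec
  obtain ⟨u, hu, hau⟩ := hf j T' fun u hu => hen u (hT.trans hu)
  exact hT' u hu hau

end Execution

theorem next_isSome {i : Fin N} {c : Config N} (h1 : c.pc i = .awaitDecision → c.turn ≠ .thinking)
    (h2 : c.pc i = .awaitTurn → c.turn = .proc i) : (next i c).isSome := by
  unfold next
  repeat' split
  all_goals simp_all

/-! ### Progress of the holder of the turn and of an exiting process -/

/-- A bound for the number of events of process `k` until it has left the critical section, if it
has the turn. -/
def approachRank (k : Fin N) (c : Config N) : ℕ :=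
  match c.pc k with
  | .critical => 1
  | .awaitTurn => 2
  | .resetFlag | .testFree => 3
  | .loopTest | .awaitDecision => 4
  | .withdraw | .setCandidate => 5
  | .withdrawTest => 6
  | .claim => 7
  | .claimTest => 8
  | .count => 9 + 2 * (c.scan k).length
  | .countOne _ => 10 + 2 * (c.scan k).length
  | .initCount => 10 + 2 * N
  | _ => 0

theorem isLocal_approachRank (k : Fin N) : IsLocal k (approachRank k) := by
  intro c c' _ h1 h2 _ _ _
  simp only [approachRank, h1, h2]

/-- Since the turn is not FREE, `withdrawTest` and `loopTest` lead out of the loop, so no new count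
begins. The hypothesis on `c'` excludes only the event that leaves the critical section. -/
theorem approachRank_lt {k : Fin N} {c c' : Config N} (h : next k c = some c') (hI : Inv c)
    (ht : c.turn = .proc k) (ht' : c'.turn = .proc k) :
    approachRank k c' < approachRank k c := by
  have hp := hI.turn.proc k ht
  have hl := length_countOrder (N := N)
  unfold approachRank
  cases event_of_next h <;> rename_i h' <;> have g1 := h'.turn <;> have g2 := h'.pc <;>
    have g3 := h'.scan <;> rw [g2, g3] <;> clear h' hI h <;> grind [PC.IsEntry]

/-- Of the events that write the turn, a claim needs it FREE and an assignment needs it THINKING;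
only the holder's exit remains. -/
theorem next_turn_of_proc {i k : Fin N} {c c' : Config N} (h : next i c = some c') (hI : Inv c)
    (ht : c.turn = .proc k) : c'.turn = .proc k ∨
      c.pc k = .critical ∧ c'.pc k = .clearFlag ∧ c'.turn = .thinking := by
  have h1 := hI.turn.critical i
  have h2 := hI.turn.exit i
  have h3 := hI.turn.claim i
  cases event_of_next h <;> rename_i h' <;> have g1 := h'.turn <;> have g2 := h'.pc <;>
    clear h' hI h <;> grind [PC.IsExit]

/-- A bound for the number of events of process `k` until it assigns the turn. -/
def exitRank (k : Fin N) (c : Config N) : ℕ :=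
  match c.pc k with
  | .assignTurn => 1
  | .nominate _ => 3
  | .elect => if c.nextTurn k = .thinking then 4 + 2 * (c.scan k).length else 2
  | .initElect => 5 + 2 * (electOrder k).length
  | .clearFlag => 6 + 2 * (electOrder k).length
  | _ => 0

theorem isLocal_exitRank (k : Fin N) : IsLocal k (exitRank k) := by
  intro c c' _ h1 h2 _ _ h3
  simp only [exitRank, h1, h2, h3]

theorem exitRank_lt {k : Fin N} {c c' : Config N} (h : next k c = some c') (hI : Inv c)
    (hp : (c.pc k).IsExit) (ht' : c'.turn = .thinking) : exitRank k c' < exitRank k c := by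
  have hn := hI.turn.nextTurn_ne k
  unfold exitRank
  cases event_of_next h <;> rename_i h' <;> have g1 := h'.turn <;> have g2 := h'.pc <;>
    have g3 := h'.scan <;> have g4 := h'.nextTurn <;> rw [g2, g3, g4] <;> clear h' hI h <;>
    grind [PC.IsExit]

theorem next_exit {i k : Fin N} {c c' : Config N} (h : next i c = some c') (hI : Inv c)
    (hp : (c.pc k).IsExit) (ht' : c'.turn = .thinking) : (c'.pc k).IsExit := by
  have hn := hI.turn.nextTurn_ne k
  rcases eq_or_ne k i with rfl | hki
  · cases event_of_next h <;> rename_i h' <;> have g1 := h'.turn <;> have g2 := h'.pc <;>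
      clear h' hI h <;> grind [PC.IsExit]
  · rwa [(next_other h hki).2.1]

/-! ### Cyclic election -/

/-- The number of steps from `k` to `i` in the cyclic order. -/
def cyclicDist (k i : Fin N) : ℕ := if k ≤ i then i.val - k.val else i.val + N - k.val

theorem cyclicDist_lt {i j k : Fin N} (hj : j ≠ k) (h : cyclicDist k j ≤ cyclicDist k i) :
    cyclicDist j i < cyclicDist k i := by
  unfold cyclicDist at *
  split_ifs at * <;> omega

theorem pairwise_electOrder (k : Fin N) :
    (electOrder k).Pairwise (fun a b => cyclicDist k a < cyclicDist k b) := by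
  unfold electOrder
  rw [List.pairwise_append]
  refine ⟨?_, ?_, ?_⟩
  · rw [List.pairwise_filter]
    refine (List.pairwise_lt_finRange N).imp fun {a b} hab ha hb => ?_
    simp only [decide_eq_true_eq] at ha hb
    unfold cyclicDist
    split_ifs <;> omega
  · rw [List.pairwise_filter]
    refine (List.pairwise_lt_finRange N).imp fun {a b} hab ha hb => ?_
    simp only [decide_eq_true_eq] at ha hb
    unfold cyclicDist
    split_ifs <;> omega
  · intro a ha b hb
    simp only [List.mem_filter, decide_eq_true_eq] at ha hb
    unfold cyclicDist
    split_ifs <;> omega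

/-- The process `k` is in its exit part and will assign the turn to a process at most as far away as
the waiting process `i`. -/
def Electing (k i : Fin N) (c : Config N) : Prop :=
  c.pc k = .clearFlag ∨ c.pc k = .initElect ∨
  c.pc k = .elect ∧ c.nextTurn k = .thinking ∧ i ∈ c.scan k ∧ (∀ j ∈ c.scan k, j ≠ k) ∧
    (c.scan k).Pairwise (fun a b => cyclicDist k a < cyclicDist k b) ∨
  (∃ j, c.pc k = .nominate j ∧ cyclicDist j i < cyclicDist k i) ∨
  (c.pc k = .elect ∨ c.pc k = .assignTurn) ∧
    ∃ j, c.nextTurn k = .proc j ∧ cyclicDist j i < cyclicDist k i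

/-- The scan is sorted by distance from `k` and stops at `i` at the latest. Hence the nominee `j`
lies after `k` and not beyond `i`, which makes it closer to `i` than `k` is. -/
theorem electing_step {k i : Fin N} {c c' : Config N} (h : next k c = some c') (hI : Inv c)
    (hi : (c.pc i).IsEntry) (hE : Electing k i c) :
    Electing k i c' ∨ ∃ j, c'.turn = .proc j ∧ cyclicDist j i < cyclicDist k i := by
  have hfi : c.flag i ≠ .remainder := by
    have := hI.allows i
    revert this hi
    cases c.pc i <;> simp +contextual [PC.IsEntry, PC.Allows]
  have hlt : ∀ j, j ≠ k → cyclicDist k j ≤ cyclicDist k i → cyclicDist j i < cyclicDist k i :=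
    fun j hj => cyclicDist_lt hj
  have hik : i ≠ k := by
    rintro rfl
    rcases hE with h | h | ⟨h, -⟩ | ⟨j, h, -⟩ | ⟨h | h, -⟩ <;> simp [h, PC.IsEntry] at hi
  have hpo := pairwise_electOrder k
  have hme : i ∈ electOrder k := mem_electOrder.2 hik
  have hmk : ∀ j ∈ electOrder k, j ≠ k := fun j => mem_electOrder.1
  unfold Electing at *
  cases event_of_next h <;> rename_i h' <;> have g1 := h'.turn <;> have g2 := h'.pc <;>
    have g3 := h'.scan <;> have g4 := h'.nextTurn <;> rw [g2, g3, g4] <;>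
    clear h' hI h hi <;> grind [List.pairwise_cons]

theorem electing_step_other {k i l : Fin N} {c c' : Config N} (h : next l c = some c')
    (hl : k ≠ l) (hE : Electing k i c) : Electing k i c' := by
  obtain ⟨-, h1, h2, -, -, h3⟩ := next_other h hl
  unfold Electing at *
  rwa [h1, h2, h3]

theorem Electing.isExit {k i : Fin N} {c : Config N} (h : Electing k i c) : (c.pc k).IsExit := by
  rcases h with h | h | ⟨h, -⟩ | ⟨j, h, -⟩ | ⟨h | h, -⟩ <;> simp [h, PC.IsExit]

/-! ### Ranks for the competition while the turn is free -/

open Classical in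
/-- A bound for the number of events of process `j` while the turn is free and process `m < j` is
a candidate. The count of process `j` ends with a withdrawal if it has still to visit `m` or has
already seen a candidate up to `m`. -/
noncomputable def followRank (m j : Fin N) (c : Config N) : ℕ :=
  let p := if m ∈ c.scan j ∨ c.pc j = .countOne m ∨
    0 ≤ c.minCandidate j ∧ c.minCandidate j ≤ (m.val : ℤ) then 0 else 2 * N + 6
  match c.pc j with
  | .resetFlag => 1
  | .loopTest => if c.flag j = .candidate then 9 + 2 * N else 2
  | .withdraw => 3
  | .withdrawTest => 4 + p
  | .claim => 5 + p
  | .claimTest => 6 + p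
  | .count => 7 + 2 * (c.scan j).length + p
  | .countOne _ => 8 + 2 * (c.scan j).length + p
  | .initCount => 8 + 2 * N
  | .setCandidate => 10 + 2 * N
  | .testFree => 11 + 2 * N
  | .awaitDecision => 12 + 2 * N
  | .remainder => 13 + 2 * N
  | _ => 0

theorem isLocal_followRank (m j : Fin N) : IsLocal j (followRank m j) := by
  intro c c' h1 h2 h3 _ h4 _
  simp only [followRank, h1, h2, h3, h4]

/-- Only a count that missed `m` can end in a retry; the penalty `2 * N + 6` puts its `withdrawTest`
just above `loopTest` at `9 + 2 * N`. In later counts the penalty is zero: `m` is still ahead or has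
been seen, and the final minimum is at most `m`, hence below `j`. -/
theorem followRank_lt {m j : Fin N} {c c' : Config N} (h : next j c = some c') (hI : Inv c)
    (ht : c.turn = .free) (ht' : c'.turn = .free) (hm : c.flag m = .candidate) (hmj : m < j) :
    followRank m j c' < followRank m j c := by
  have hl := length_countOrder (N := N)
  have hmc := mem_countOrder m
  have hd := (hI.count j).done
  have hlt := (hI.count j).lt_one m
  have hlt' := (hI.count j).lt_min
  have hlt2 := (hI.count j).one_lt_min
  have hA := hI.allows j
  have he := hI.turn.exit j
  have hc := hI.turn.critical j
  unfold followRank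
  cases event_of_next h <;> rename_i h' <;> obtain ⟨g1, g2, g3, g4, g5, g6, g7⟩ := h' <;>
    rw [g2, g3, g4, g6] <;> clear hI h g5 g7 <;> grind [PC.IsExit, PC.Allows]

theorem followRank_lt_of_not_contending {i : Fin N} {c c' : Config N} (h : next i c = some c')
    (ht : c.turn = .free) (hp : (c.pc i).IsEntry)
    (hc : ¬ (c.pc i).IsContending) (hc' : ¬ (c'.pc i).IsContending) :
    followRank i i c' < followRank i i c := by
  unfold followRank
  cases event_of_next h <;> rename_i h' <;> obtain ⟨g1, g2, g3, g4, g5, g6, g7⟩ := h' <;>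
    rw [g3] <;> clear h g5 g7 <;> grind [PC.IsEntry, PC.IsContending]

theorem next_turn_of_free {i : Fin N} {c c' : Config N} (h : next i c = some c') (hI : Inv c)
    (ht : c.turn = .free) : c'.turn = .free ∨ ∃ k, c'.turn = .proc k := by
  have h1 := hI.turn.critical i
  have h2 := hI.turn.exit i
  cases event_of_next h <;> rename_i h' <;> have g1 := h'.turn <;> clear h' hI h <;>
    grind [PC.IsExit]

/-- A bound for the number of events of process `m` until it takes the turn, if there is no other
candidate and it does not withdraw. -/
def leadRank (m : Fin N) (c : Config N) : ℕ :=
  let p := if observed c m = selfVisits c m then 0 else 2 * N + 5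
  match c.pc m with
  | .claim => 1
  | .claimTest => 2 + p
  | .count => 3 + 2 * (c.scan m).length + p
  | .countOne _ => 4 + 2 * (c.scan m).length + p
  | .initCount => 4 + 2 * N
  | .loopTest => 5 + 2 * N
  | .withdrawTest => 6 + 2 * N
  | _ => 0

theorem isLocal_leadRank (m : Fin N) : IsLocal m (leadRank m) := by
  intro c c' _ h1 h2 h3 _ _
  have ho : observed c' m = observed c m := by simp only [observed, h1, h3]
  have hv : selfVisits c' m = selfVisits c m := by simp only [selfVisits, h2]
  simp only [leadRank, ho, hv, h1, h2]

/-- Each of the states excluded here would require a smaller contender, by `FreeInv.withdrawing`. -/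
theorem Inv.lead_flag {c : Config N} (hI : Inv c) (ht : c.turn = .free) {m : Fin N}
    (hm : (c.pc m).IsContending) (hmin : ∀ j < m, ¬ (c.pc j).IsContending) :
    c.flag m = .candidate ∧ c.pc m ≠ .withdraw ∧ c.pc m ≠ .resetFlag := by
  have hA := hI.allows m
  have hw := hI.free.withdrawing ht m
  generalize c.pc m = p at *
  cases p <;> grind [PC.IsContending, PC.Allows]

/-- The penalty `2 * N + 5` lets a count spoiled by earlier candidates fail once: it puts
`claimTest` just above `withdrawTest`. A count begun when no other candidate exists keeps `observed`
equal to `selfVisits`, so it ends with one candidate and a claim. -/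
theorem leadRank_lt {m : Fin N} {c c' : Config N} (h : next m c = some c') (hI : Inv c)
    (ht : c.turn = .free) (ht' : c'.turn = .free) (hm : (c.pc m).IsContending)
    (hf : c.flag m = .candidate) (hr : c.pc m ≠ .resetFlag) (hw : c.pc m ≠ .withdraw)
    (hw' : c'.pc m ≠ .withdraw) (ho : ∀ j, j ≠ m → c.flag j ≠ .candidate) : leadRank m c' <
      leadRank m c := by
  have hl := length_countOrder (N := N)
  have hmc := mem_countOrder m
  have hd := (hI.count m).done
  have hs := (hI.count m).sorted
  have hA := hI.allows m
  unfold leadRank observed selfVisits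
  cases event_of_next h <;> rename_i h' <;> obtain ⟨g1, g2, g3, g4, g5, g6, g7⟩ := h' <;>
    rw [g3, g4, g5] <;> clear hI h g6 g7 <;>
    grind [PC.IsContending, PC.Allows, List.pairwise_cons]

/-! ### Liveness -/

section Execution

variable {s : ℕ → Config N} {a : ℕ → Option (Fin N)}

theorem IsExecution.entry_succ (h : IsExecution s a) {i : Fin N} {u : ℕ}
    (hp : ((s u).pc i).IsEntry) (ht : (s u).turn ≠ .proc i) : ((s (u + 1)).pc i).IsEntry := by
  rcases h.step u with h | ⟨k, h⟩
  · rwa [h]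
  · exact (next_entry h hp).resolve_right fun h => ht h.2

theorem IsExecution.entry_of_le (h : IsExecution s a) {i : Fin N} {u v : ℕ} (huv : u ≤ v)
    (hp : ((s u).pc i).IsEntry) (ht : ∀ w, u ≤ w → (s w).turn ≠ .proc i) :
    ((s v).pc i).IsEntry := by
  induction v, huv using Nat.le_induction with
  | base => exact hp
  | succ v hv ih => exact h.entry_succ ih (ht v hv)

/-- A process that has the turn enters its critical section and leaves it. -/
theorem IsExecution.exists_critical (h : IsExecution s a) (hf : IsFair s a) {k : Fin N} {u : ℕ}
    (hk : (s u).turn = .proc k) : ∃ v, u ≤ v ∧ (s v).pc k = .critical ∧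
      (s (v + 1)).pc k = .clearFlag := by
  by_contra! hc
  have ht : ∀ v, u ≤ v → (s v).turn = .proc k := by
    intro v hv
    induction v, hv using Nat.le_induction with
    | base => exact hk
    | succ v hv ih =>
      rcases h.step v with h1 | ⟨i, h1⟩
      · rwa [h1]
      · exact (next_turn_of_proc h1 (h.inv v) ih).resolve_right fun h2 => hc v hv h2.1 h2.2.1
  refine h.not_enabled hf (isLocal_approachRank k) (T := u) (fun v hv => ⟨?_, ?_⟩)
    fun v hv hn => approachRank_lt hn (h.inv v) (ht v hv) (ht _ (by omega))
  · intro hp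
    have := (h.inv v).turn.proc k (ht v hv)
    simp [hp, PC.IsEntry] at this
  · exact next_isSome (fun _ => by simp [ht v hv]) fun _ => ht v hv

/-- A process in its exit part assigns the turn. -/
theorem IsExecution.exists_turn_ne_thinking (h : IsExecution s a) (hf : IsFair s a) {k : Fin N}
    {u : ℕ} (hk : ((s u).pc k).IsExit) : ∃ v, u ≤ v ∧ (s v).turn ≠ .thinking := by
  by_contra! ht
  have hp : ∀ v, u ≤ v → ((s v).pc k).IsExit := by
    intro v hv
    induction v, hv using Nat.le_induction with
    | base => exact hk
    | succ v hv ih =>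
      rcases h.step v with h1 | ⟨i, h1⟩
      · rwa [h1]
      · exact next_exit h1 (h.inv v) ih (ht _ (by omega))
  refine h.not_enabled hf (isLocal_exitRank k) (T := u) (fun v hv => ⟨?_, next_isSome ?_ ?_⟩)
    fun v hv hn => exitRank_lt hn (h.inv v) (hp v hv) (ht _ (by omega))
  all_goals
    intro h1
    have := hp v hv
    simp [h1, PC.IsExit] at this

theorem IsExecution.contending_of_le (h : IsExecution s a) {T u v : ℕ}
    (ht : ∀ w, T ≤ w → (s w).turn = .free) (hu : T ≤ u) (huv : u ≤ v) {j : Fin N}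
    (hj : ((s u).pc j).IsContending) : ((s v).pc j).IsContending := by
  induction v, huv using Nat.le_induction with
  | base => exact hj
  | succ v hv ih =>
    rcases h.step v with h1 | ⟨i, h1⟩
    · rwa [h1]
    · exact next_contending h1 (ht _ (by omega)) (h.inv v).turn ih

/-- If the turn stays free, a process in its entry part becomes a candidate. -/
theorem IsExecution.exists_contending (h : IsExecution s a) (hf : IsFair s a) {T : ℕ}
    (ht : ∀ w, T ≤ w → (s w).turn = .free) {i : Fin N} (hi : ((s T).pc i).IsEntry) :
    ∃ u, T ≤ u ∧ ((s u).pc i).IsContending := by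
  by_contra! hc
  have hp : ∀ v, T ≤ v → ((s v).pc i).IsEntry := fun v hv =>
    h.entry_of_le hv hi fun w hw => by simp [ht w hw]
  -- Only the values of the rank before `loopTest` matter here, and they do not depend on its first
  -- argument.
  refine h.not_enabled hf (isLocal_followRank i i) (T := T) (fun v hv => ⟨?_, next_isSome ?_ ?_⟩)
    fun v hv hn => followRank_lt_of_not_contending hn (ht v hv) (hp v hv) (hc v hv)
      (hc _ (by omega))
  · intro h1
    have := hp v hv
    simp [h1, PC.IsEntry] at this
  · simp [ht v hv]
  · intro h1
    have := hc v hv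
    simp [h1, PC.IsContending] at this

/-- While the turn is free and `m` is a candidate, a process `j > m` eventually gives up. -/
theorem IsExecution.eventually_not_candidate (h : IsExecution s a) (hf : IsFair s a) {T : ℕ}
    (ht : ∀ w, T ≤ w → (s w).turn = .free) {m j : Fin N} (hmj : m < j)
    (hm : ∀ w, T ≤ w → (s w).flag m = .candidate) :
    ∃ T', ∀ u, T' ≤ u → (s u).flag j ≠ .candidate := by
  obtain ⟨T', hT, hT'⟩ := h.eventually_ne (isLocal_followRank m j) (T := T) fun u hu hn =>
    followRank_lt hn (h.inv u) (ht u hu) (ht _ (by omega)) (hm u hu) hmj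
  -- After `T'` process `j` is inactive, yet a process whose flag stays CANDIDATE is always enabled;
  -- so the flag has another value at some time, and from then on it is frozen.
  obtain ⟨v, hv, hfv⟩ : ∃ v, T' ≤ v ∧ (s v).flag j ≠ .candidate := by
    by_contra! hc
    obtain ⟨u, hu, hau⟩ := hf j T' fun u hu => by
      have hA := (h.inv u).allows j
      rw [hc u hu] at hA
      refine ⟨?_, next_isSome ?_ ?_⟩ <;> intro hp <;> simp [hp, PC.Allows] at hA
    exact hT' u hu hau
  refine ⟨v, fun u hu => ?_⟩
  induction u, hu using Nat.le_induction with
  | base => exact hfv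
  | succ u hu ih =>
    have hl : IsLocal j fun c : Config N => c.flag j := fun c c' h1 _ _ _ _ _ => h1
    rwa [h.local_of_ne hl (hT' u (hv.trans hu))]

/-- The turn does not stay free if a process is in its entry part. -/
theorem IsExecution.not_forever_free (h : IsExecution s a) (hf : IsFair s a) {T : ℕ}
    (ht : ∀ w, T ≤ w → (s w).turn = .free) {i : Fin N} (hi : ((s T).pc i).IsEntry) : False := by
  obtain ⟨m, ⟨u, hu, hm⟩, hmin⟩ := wellFounded_lt.has_min
    {j : Fin N | ∃ u, T ≤ u ∧ ((s u).pc j).IsContending} ⟨i, h.exists_contending hf ht hi⟩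
  have hmin' : ∀ v, T ≤ v → ∀ j < m, ¬ ((s v).pc j).IsContending := fun v hv j hj hc =>
    hmin j ⟨v, hv, hc⟩ hj
  have hcm : ∀ v, u ≤ v → ((s v).pc m).IsContending := fun v hv => h.contending_of_le ht hu hv hm
  have hlead := fun v (hv : u ≤ v) =>
    (h.inv v).lead_flag (ht v (hu.trans hv)) (hcm v hv) (hmin' v (hu.trans hv))
  -- The condition `j ≠ m` stands inside the existential so that one time can be chosen for every
  -- `j`, with a dummy value at `m`; the maximum of these times is then finite.
  have hquiet : ∀ j, ∃ T', j ≠ m → ∀ v, T' ≤ v → (s v).flag j ≠ .candidate := by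
    intro j
    rcases lt_trichotomy j m with hj | rfl | hj
    · exact ⟨T, fun _ v hv hc => hmin' v hv j hj (((h.inv v).allows j).contending hc)⟩
    · exact ⟨0, fun h => absurd rfl h⟩
    · obtain ⟨T', hT'⟩ := h.eventually_not_candidate hf (T := u) (fun w hw => ht w (hu.trans hw))
        hj fun w hw => (hlead w hw).1
      exact ⟨T', fun _ => hT'⟩
  choose f hquiet using hquiet
  set T' := max u (Finset.univ.sup f) with hT'
  have hle : ∀ j, f j ≤ T' := fun j =>
    (Finset.le_sup (f := f) (Finset.mem_univ j)).trans (le_max_right _ _)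
  have hu' : u ≤ T' := le_max_left _ _
  refine h.not_enabled hf (isLocal_leadRank m) (T := T') (fun v hv => ⟨?_, next_isSome ?_ ?_⟩)
    fun v hv hn => leadRank_lt hn (h.inv v) (ht v (by omega)) (ht _ (by omega))
      (hcm v (by omega)) (hlead v (by omega)).1 (hlead v (by omega)).2.2 (hlead v (by omega)).2.1
      (hlead (v + 1) (by omega)).2.1 fun j hj => hquiet j hj v ((hle j).trans hv)
  all_goals
    intro hp
    have hA := (h.inv v).allows m
    simp [hp, PC.Allows, (hlead v (by omega)).1] at hA

/-- If a process is in its entry part, then the turn is eventually given to some process. -/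
theorem IsExecution.exists_turn_proc (h : IsExecution s a) (hf : IsFair s a) {i : Fin N} {u : ℕ}
    (hi : ((s u).pc i).IsEntry) : ∃ v, u ≤ v ∧ ∃ k, (s v).turn = .proc k := by
  by_contra! hc
  have hp : ∀ v, u ≤ v → ((s v).pc i).IsEntry := fun v hv =>
    h.entry_of_le hv hi fun w hw => hc w hw i
  obtain ⟨T, hT, hfree⟩ : ∃ T, u ≤ T ∧ (s T).turn = .free := by
    have key : ∃ v, u ≤ v ∧ (s v).turn ≠ .thinking := by
      by_cases ht : (s u).turn = .thinking
      · obtain ⟨k, hk⟩ := (h.inv u).turn.thinking ht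
        exact h.exists_turn_ne_thinking hf hk
      · exact ⟨u, le_rfl, ht⟩
    obtain ⟨v, hv, hne⟩ := key
    refine ⟨v, hv, ?_⟩
    cases hs : (s v).turn with
    | proc k => exact absurd hs (hc v hv k)
    | thinking => exact absurd hs hne
    | free => rfl
  refine h.not_forever_free hf (T := T) (fun w hw => ?_) (hp T hT)
  induction w, hw using Nat.le_induction with
  | base => exact hfree
  | succ w hw ih =>
    rcases h.step w with h1 | ⟨k, h1⟩
    · rwa [h1]
    · exact (next_turn_of_free h1 (h.inv w) ih).resolve_right fun ⟨k, hk⟩ =>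
        hc (w + 1) (by omega) k hk

/-- If process `k` elects while process `i` waits, then the turn comes closer to `i`. -/
theorem IsExecution.exists_closer (h : IsExecution s a) (hf : IsFair s a) {i k : Fin N} {u : ℕ}
    (hi : ∀ v, u ≤ v → ((s v).pc i).IsEntry) (hk : Electing k i (s u)) :
    ∃ v, u ≤ v ∧ ∃ j, (s v).turn = .proc j ∧ cyclicDist j i < cyclicDist k i := by
  by_contra! hc
  have hE : ∀ v, u ≤ v → Electing k i (s v) := by
    intro v hv
    induction v, hv using Nat.le_induction with
    | base => exact hk
    | succ v hv ih =>
      rcases h.step v with h1 | ⟨l, h1⟩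
      · rwa [h1]
      · by_cases hl : k = l
        · subst hl
          refine (electing_step h1 (h.inv v) (hi v hv) ih).resolve_right fun ⟨j, hj, hlt⟩ => ?_
          exact absurd (hc (v + 1) (by omega) j hj) (not_le.2 hlt)
        · exact electing_step_other h1 hl ih
  -- If no closer process ever got the turn, `Electing` would persist and keep the turn THINKING,
  -- but an exiting process must assign it.
  obtain ⟨v, hv, hne⟩ := h.exists_turn_ne_thinking hf hk.isExit
  exact hne ((h.inv v).turn.exit k (hE v hv).isExit)

/-- A process in its entry part is eventually given the turn. -/
theorem IsExecution.exists_turn_eq (h : IsExecution s a) (hf : IsFair s a) {i : Fin N} {u : ℕ}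
    (hi : ((s u).pc i).IsEntry) : ∃ v, u ≤ v ∧ (s v).turn = .proc i := by
  by_contra! hc
  have hp : ∀ v, u ≤ v → ((s v).pc i).IsEntry := fun v hv => h.entry_of_le hv hi hc
  have key : ∀ n k v, u ≤ v → (s v).turn = .proc k → cyclicDist k i = n → False := by
    intro n
    induction n using Nat.strong_induction_on with
    | _ n ih =>
      intro k v hv hk hn
      obtain ⟨w, hw, -, hw'⟩ := h.exists_critical hf hk
      obtain ⟨x, hx, j, hj, hlt⟩ := h.exists_closer hf (k := k) (u := w + 1)
        (fun y hy => hp y (by omega)) (.inl hw')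
      exact ih _ (hn ▸ hlt) j x (by omega) hj rfl
  obtain ⟨v, hv, k, hk⟩ := h.exists_turn_proc hf hi
  exact key _ k v hv hk rfl

end Execution

end SymmetricMutex

/-- A process whose flag is not REMAINDER, and which is not just between leaving its critical
section and resetting its flag, is eventually given the turn and then enters its critical
section. -/
theorem theorem3p9 (N : ℕ) (s : ℕ → SymmetricMutex.Config N) (a : ℕ → Option (Fin N))
    (hexec : SymmetricMutex.IsExecution s a) (hfair : SymmetricMutex.IsFair s a)
    (i : Fin N) (t : ℕ) (hflag : (s t).flag i ≠ SymmetricMutex.Flag.remainder)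
    (hpc : (s t).pc i ≠ SymmetricMutex.PC.clearFlag) :
    ∃ t₁, t ≤ t₁ ∧ (s t₁).turn = SymmetricMutex.Turn.proc i ∧
      ∃ t₂, t₁ ≤ t₂ ∧ (s t₂).pc i = SymmetricMutex.PC.critical := by
  obtain ⟨t₁, h₁, hturn⟩ : ∃ t₁, t ≤ t₁ ∧ (s t₁).turn = SymmetricMutex.Turn.proc i := by
    rcases ((hexec.inv t).allows i).cases hflag with h | h | h
    · exact hexec.exists_turn_eq hfair h
    · exact ⟨t, le_rfl, (hexec.inv t).turn.critical i h⟩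
    · exact absurd h hpc
  obtain ⟨t₂, h₂, hcrit, -⟩ := hexec.exists_critical hfair hturn
  exact ⟨t₁, h₁, hturn, t₂, h₂, hcrit⟩
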